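/- A left-order on a group $G$ is a strict total order $\prec$ on $G$ such that $a\prec b$ if and only if $ca\prec cb$, for all $a,b,c\in G$; its positive cone is $\{g\in G : 1\prec g\}$. A left-order is called regular if there are a finite set $X$, a surjective monoid homomorphism $\pi\colon X^*\to G$ from the free monoid on $X$, and a regular language $L\subseteq X^*$ (one accepted by a finite state automaton) such that $\pi(L)$ is the positive cone. Let $A$ and $B$ be groups that admit regular left-orders, and let $A*B$ be their free product. Then $(A*B)\times\mathbb{Z}$ admits a regular left-order. On the other hand, if $A$ and $B$ are both non-trivial, then $A*B$ itself does not admit a regular left-order. -/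

import Mathlib

universe u v

/-- A strict total order on a group, invariant under left multiplication. -/
structure IsLeftOrder (G : Type u) [Group G] (lt : G → G → Prop) : Prop where
  strictTotal : IsStrictTotalOrder G lt
  mul_left_iff : ∀ a b c : G, lt (c * a) (c * b) ↔ lt a b

/-- The positive cone of a left-order: the elements greater than the identity. -/
def positiveCone {G : Type u} [Group G] (lt : G → G → Prop) : Set G :=
  {g | lt 1 g}

/-- The evaluation `X* → G` of words over an alphabet `X`: the monoid homomorphism that extends
a map `X → G`. -/
def wordEval {G : Type u} [Group G] {X : Type v} (ev : X → G) (w : List X) : G :=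
  (w.map ev).prod

/-- A left-order is regular if there is a finite (monoid) generating set `X` of the group and a
regular language over `X` that evaluates onto the positive cone. (A finite alphabet can be taken
in `Type`.) -/
structure IsRegularLeftOrder (G : Type u) [Group G] (lt : G → G → Prop) : Prop where
  isLeftOrder : IsLeftOrder G lt
  exists_language : ∃ (X : Type) (_ : Finite X) (ev : X → G),
    Function.Surjective (wordEval ev) ∧
      ∃ L : Language X, L.IsRegular ∧ wordEval ev '' {w : List X | w ∈ L} = positiveCone lt

/-- The group admits a regular left-order. -/
def AdmitsRegularLeftOrder (G : Type u) [Group G] : Prop :=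
  ∃ lt : G → G → Prop, IsRegularLeftOrder G lt

/-! For the positive half, let `z` generate the central factor `ℤ`. Every non-trivial letter of `A`
or `B` is given a fixed power of `z`: `s true` consists of `a` for `a > 1` and `a z` for `a < 1` in
`A`, and `s false` of `b` for `b < 1` and `b z⁻¹` for `b > 1` in `B`. A product of two elements of
`s true` gains at most a factor `z`, and one of two elements of `s false` at most a factor `z⁻¹`
(`IsTwistedPair`). Each element of the group is an alternating product, or `1`, times some `z ^ k`.
It is declared positive if `k ≥ 0` and the product starts in `s true`, or if `k ≥ 1` otherwise. A
cancellation that costs a `z⁻¹` always exposes a letter of the other kind, whose threshold is lower,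
so the positive elements form a semigroup (`IsTwistedPair.mul_mem`). Exchanging the two sets and
inverting `z` gives the negative elements. The cone is rational because a finite combination of `s
true`, `s false` and `z` generates it as a semigroup.

For the negative half, let `S` be the set of elements of `A * B` whose normal form starts in `A`. A
right translation moves only finitely many elements out of `S`. Both `S` and its complement are
cofinal in any left-order, so there are `f ∈ S` and `t ∉ S` with `t > f`, where `f` lies above any
given finite set. A word of the regular language for `f⁻¹ t` leads from `f` to `t` and leaves `S` at
one of finitely many points. By regularity one of finitely many words completes the path from there
to a positive word, so it ends above `f` but in a finite set fixed beforehand: a contradiction. -/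

theorem wordEval_append {G : Type u} [Group G] {X : Type v} (ev : X → G) (w w' : List X) :
    wordEval ev (w ++ w') = wordEval ev w * wordEval ev w' := by
  simp [wordEval]

theorem wordEval_cons {G : Type u} [Group G] {X : Type v} (ev : X → G) (x : X) (w : List X) :
    wordEval ev (x :: w) = ev x * wordEval ev w := by
  simp [wordEval]

/-! ### Closure properties of regular languages, by counting left quotients -/

namespace Language

variable {T : Type u} {T' : Type v}

/-- Regular languages are closed under relabelling of the letters. -/
theorem IsRegular.map {L : Language T} (hL : L.IsRegular) (f : T → T') :
    (Language.map f L).IsRegular := by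
  classical
  obtain ⟨σ, _, M, rfl⟩ := hL
  let N : NFA T' σ :=
    { step := fun s y ↦ {t | ∃ x, f x = y ∧ M.step s x = t}
      start := {M.start}
      accept := M.accept }
  have key : ∀ (w' : List T') (s t : σ),
      t ∈ N.evalFrom {s} w' ↔ ∃ w : List T, w.map f = w' ∧ M.evalFrom s w = t := by
    intro w'
    induction w' with
    | nil => intro s t; simp [eq_comm]
    | cons y w' ih =>
      intro s t
      rw [NFA.evalFrom_cons, NFA.mem_evalFrom_iff_exists]
      constructor
      · rintro ⟨r, hr, ht⟩
        rw [NFA.stepSet_singleton] at hr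
        obtain ⟨x, rfl, rfl⟩ := hr
        obtain ⟨w, rfl, rfl⟩ := (ih _ _).1 ht
        exact ⟨x :: w, rfl, rfl⟩
      · rintro ⟨w, hw, rfl⟩
        obtain ⟨x, w, rfl, rfl, rfl⟩ := List.map_eq_cons_iff.1 hw
        exact ⟨M.step s x, by rw [NFA.stepSet_singleton]; exact ⟨x, rfl, rfl⟩,
          (ih _ _).2 ⟨w, rfl, rfl⟩⟩
  refine (Language.isRegular_iff).2 ⟨Set σ, inferInstance, N.toDFA, ?_⟩
  rw [NFA.toDFA_correct]
  ext w'
  rw [NFA.mem_accepts]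
  constructor
  · rintro ⟨t, ht, h⟩
    obtain ⟨w, rfl, rfl⟩ := (key _ _ _).1 h
    exact ⟨w, ht, rfl⟩
  · rintro ⟨w, hw, rfl⟩
    exact ⟨_, hw, (key _ _ _).2 ⟨w, rfl, rfl⟩⟩

theorem mem_sSup {S : Set (Language T)} {w : List T} : w ∈ sSup S ↔ ∃ L ∈ S, w ∈ L :=
  Set.mem_sUnion

/-- Regular languages are closed under concatenation. -/
theorem IsRegular.mul {L M : Language T} (hL : L.IsRegular) (hM : M.IsRegular) :
    (L * M).IsRegular := by
  apply IsRegular.of_finite_range_leftQuotient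
  -- The quotient of `L * M` by `x` depends only on the quotient of `L` by `x` and on the set of
  -- quotients of `M` by those `v` with `x = u ++ v`, `u ∈ L`. There are finitely many such pairs.
  have hfin := (hL.finite_range_leftQuotient.prod hM.finite_range_leftQuotient.powerset).image
    fun p : Language T × Set (Language T) ↦ p.1 * M + sSup p.2
  refine hfin.subset ?_
  rintro _ ⟨x, rfl⟩
  refine ⟨(L.leftQuotient x, {K | ∃ u v, u ++ v = x ∧ u ∈ L ∧ K = M.leftQuotient v}),
    ⟨⟨x, rfl⟩, ?_⟩, ?_⟩
  · rintro K ⟨u, v, -, -, rfl⟩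
    exact ⟨v, rfl⟩
  · ext w
    simp only [Language.mem_add, Language.mem_mul, Language.mem_sSup, Language.mem_leftQuotient]
    constructor
    · rintro (⟨u, hu, v, hv, rfl⟩ | ⟨K, ⟨u, v, rfl, hu, rfl⟩, hw⟩)
      · exact ⟨x ++ u, hu, v, hv, by simp⟩
      · exact ⟨u, hu, v ++ w, hw, by simp⟩
    · rintro ⟨u, hu, v, hv, h⟩
      rcases List.append_eq_append_iff.1 h with ⟨c, rfl, rfl⟩ | ⟨c, rfl, rfl⟩
      · exact .inr ⟨_, ⟨u, c, rfl, hu, rfl⟩, hv⟩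
      · exact .inl ⟨c, hu, v, hv, rfl⟩

/-- Regular languages are closed under the Kleene star. -/
theorem IsRegular.kstar {L : Language T} (hL : L.IsRegular) : (KStar.kstar L).IsRegular := by
  apply IsRegular.of_finite_range_leftQuotient
  have hfin := (hL.finite_range_leftQuotient.powerset).image
    fun p : Set (Language T) ↦ sSup p * KStar.kstar L
  refine (hfin.union (Set.finite_singleton (KStar.kstar L))).subset ?_
  rintro _ ⟨x, rfl⟩
  -- The empty word is set apart: the formula below would give `L * L∗`, which may miss the empty
  -- word.
  rcases eq_or_ne x [] with rfl | hx
  · right; simp [Language.leftQuotient_nil]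
  left
  refine ⟨{K | ∃ u v, u ++ v = x ∧ u ∈ KStar.kstar L ∧ K = L.leftQuotient v}, ?_, ?_⟩
  · rintro K ⟨u, v, -, -, rfl⟩
    exact ⟨v, rfl⟩
  · have hmul : ∀ {u v : List T}, u ∈ KStar.kstar L → v ∈ KStar.kstar L →
        u ++ v ∈ KStar.kstar L := fun hu hv ↦ by
      rw [← kstar_mul_kstar L]; exact Language.append_mem_mul hu hv
    have hle : ∀ {u : List T}, u ∈ L → u ∈ KStar.kstar L := fun hu ↦ (le_kstar : L ≤ _) hu
    ext w
    simp only [Language.mem_mul, Language.mem_sSup, Language.mem_leftQuotient]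
    constructor
    · rintro ⟨c, ⟨K, ⟨u, v, rfl, hu, rfl⟩, hc⟩, d, hd, rfl⟩
      have := hmul hu (hmul (hle hc) hd)
      simpa using this
    · intro h
      obtain ⟨S, hS, hSL⟩ := Language.mem_kstar.1 h
      clear h
      -- `p` collects the factors already passed; `x` is what remains to be read up to the cut.
      suffices H : ∀ (S : List (List T)) (p x w : List T), p ∈ KStar.kstar L → x ≠ [] →
          x ++ w = S.flatten → (∀ y ∈ S, y ∈ L) →
          ∃ a, (∃ K, (∃ u v, u ++ v = p ++ x ∧ u ∈ KStar.kstar L ∧ K = L.leftQuotient v) ∧ a ∈ K) ∧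
            ∃ b ∈ KStar.kstar L, a ++ b = w by
        obtain ⟨a, ha, b, hb⟩ := H S [] x w (Language.nil_mem_kstar L) hx hS hSL
        exact ⟨a, ha, b, hb⟩
      intro S
      induction S with
      | nil => intro p x w _ hx h; simp at h; exact absurd h.1 hx
      | cons y S ih =>
        intro p x w hp hx h hS
        rw [List.flatten_cons] at h
        have hSt : ∀ z ∈ S, z ∈ L := fun z hz ↦ hS z (by simp [hz])
        rcases List.append_eq_append_iff.1 h with ⟨c, rfl, rfl⟩ | ⟨c, rfl, hc⟩
        · exact ⟨c, ⟨_, ⟨p, x, rfl, hp, rfl⟩, hS _ (by simp)⟩, _,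
            Language.mem_kstar.2 ⟨S, rfl, hSt⟩, rfl⟩
        -- If the cut falls between two factors, the whole factor `y` before it is taken as the
        -- unfinished piece, with empty completion.
        · rcases eq_or_ne c [] with rfl | hc0
          · refine ⟨[], ⟨_, ⟨p, y, by simp, hp, rfl⟩, ?_⟩, w,
              Language.mem_kstar.2 ⟨S, by simpa using hc.symm, hSt⟩, rfl⟩
            simpa [Language.mem_leftQuotient] using hS y (by simp)
          · have := ih (p ++ y) c w (hmul hp (hle (hS y (by simp)))) hc0 hc.symm hSt
            simpa using this

end Language

/-! ### Rational subsets of groups -/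

/-- A subset of a group is rational if it is the image of a regular language over a finite
alphabet. -/
def IsRationalSubset {G : Type u} [Group G] (R : Set G) : Prop :=
  ∃ (X : Type) (_ : Finite X) (ev : X → G) (L : Language X),
    L.IsRegular ∧ wordEval ev '' {w : List X | w ∈ L} = R

namespace IsRationalSubset

variable {G : Type u} [Group G]

theorem of_eq {R S : Set G} (hR : IsRationalSubset R) (h : R = S) : IsRationalSubset S :=
  h ▸ hR

theorem image {H : Type v} [Group H] {R : Set G} (hR : IsRationalSubset R) (f : G →* H) :
    IsRationalSubset (f '' R) := by
  obtain ⟨X, hX, ev, L, hL, rfl⟩ := hR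
  refine ⟨X, hX, f ∘ ev, L, hL, ?_⟩
  rw [Set.image_image]
  refine Set.image_congr fun w _ ↦ ?_
  simp [wordEval, map_list_prod]

theorem inv {R : Set G} (hR : IsRationalSubset R) : IsRationalSubset R⁻¹ := by
  obtain ⟨X, hX, ev, L, hL, rfl⟩ := hR
  have key : ∀ w : List X, wordEval (fun x ↦ (ev x)⁻¹) w.reverse = (wordEval ev w)⁻¹ := by
    intro w
    simp [wordEval, List.prod_inv_reverse, Function.comp_def]
  refine ⟨X, hX, fun x ↦ (ev x)⁻¹, L.reverse, hL.reverse, ?_⟩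
  ext g
  constructor
  · rintro ⟨w, hw, rfl⟩
    refine ⟨w.reverse, hw, ?_⟩
    rw [← inv_inv (wordEval ev w.reverse), ← key, List.reverse_reverse]
  · rintro ⟨w, hw, h⟩
    refine ⟨w.reverse, ?_, ?_⟩
    · simpa [Language.mem_reverse] using hw
    · rw [key, h, inv_inv]

theorem singleton (g : G) : IsRationalSubset {g} := by
  refine ⟨Unit, inferInstance, fun _ ↦ g, {[()]}, ?_, ?_⟩
  · apply Language.IsRegular.of_finite_range_leftQuotient
    have hfin := ((Set.finite_singleton (0 : Language Unit)).insert {[]}).insert {[()]}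
    refine hfin.subset ?_
    rintro _ ⟨x, rfl⟩
    rcases x with _ | ⟨_, _ | ⟨_, x⟩⟩
    · exact .inl rfl
    · refine .inr (.inl ?_)
      ext w
      change [()] ++ w = [()] ↔ w = []
      simp
    · refine .inr (.inr ?_)
      ext w
      change () :: () :: x ++ w = [()] ↔ False
      simp
  · change wordEval _ '' {[()]} = _
    simp [wordEval]

/-- Two rational subsets can be represented by languages over the same alphabet. -/
theorem exists_common {R S : Set G} (hR : IsRationalSubset R) (hS : IsRationalSubset S) :
    ∃ (X : Type) (_ : Finite X) (ev : X → G) (L M : Language X), L.IsRegular ∧ M.IsRegular ∧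
      wordEval ev '' {w : List X | w ∈ L} = R ∧ wordEval ev '' {w : List X | w ∈ M} = S := by
  obtain ⟨X, hX, ev, L, hL, rfl⟩ := hR
  obtain ⟨Y, hY, ev', M, hM, rfl⟩ := hS
  refine ⟨X ⊕ Y, inferInstance, Sum.elim ev ev', _, _, hL.map Sum.inl, hM.map Sum.inr, ?_, ?_⟩
  · exact (Set.image_image _ (List.map Sum.inl) {w | w ∈ L}).trans
      (Set.image_congr fun w _ ↦ by simp [wordEval])
  · exact (Set.image_image _ (List.map Sum.inr) {w | w ∈ M}).trans
      (Set.image_congr fun w _ ↦ by simp [wordEval])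

open scoped Pointwise in
theorem mul {R S : Set G} (hR : IsRationalSubset R) (hS : IsRationalSubset S) :
    IsRationalSubset (R * S) := by
  obtain ⟨X, hX, ev, L, M, hL, hM, rfl, rfl⟩ := hR.exists_common hS
  refine ⟨X, hX, ev, L * M, hL.mul hM, ?_⟩
  ext g
  constructor
  · rintro ⟨_, ⟨u, hu, v, hv, rfl⟩, rfl⟩
    exact ⟨_, ⟨u, hu, rfl⟩, _, ⟨v, hv, rfl⟩, (wordEval_append ev u v).symm⟩
  · rintro ⟨_, ⟨u, hu, rfl⟩, _, ⟨v, hv, rfl⟩, rfl⟩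
    exact ⟨u ++ v, Language.append_mem_mul hu hv, wordEval_append ev u v⟩

theorem union {R S : Set G} (hR : IsRationalSubset R) (hS : IsRationalSubset S) :
    IsRationalSubset (R ∪ S) := by
  obtain ⟨X, hX, ev, L, M, hL, hM, rfl, rfl⟩ := hR.exists_common hS
  exact ⟨X, hX, ev, L + M, hL.add hM, by rw [← Set.image_union]; rfl⟩

theorem submonoidClosure {R : Set G} (hR : IsRationalSubset R) :
    IsRationalSubset (Submonoid.closure R : Set G) := by
  obtain ⟨X, hX, ev, L, hL, rfl⟩ := hR
  refine ⟨X, hX, ev, KStar.kstar L, hL.kstar, ?_⟩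
  ext g
  constructor
  · rintro ⟨w, hw, rfl⟩
    obtain ⟨S, rfl, hS⟩ := Language.mem_kstar.1 hw
    clear hw
    induction S with
    | nil => exact one_mem _
    | cons y S ih =>
      rw [List.flatten_cons, wordEval_append]
      exact mul_mem (Submonoid.subset_closure ⟨y, hS y (by simp), rfl⟩)
        (ih fun z hz ↦ hS z (by simp [hz]))
  · intro hg
    induction hg using Submonoid.closure_induction with
    | mem x hx =>
      obtain ⟨w, hw, rfl⟩ := hx
      exact ⟨w, (le_kstar : L ≤ _) hw, rfl⟩
    | one => exact ⟨[], Language.nil_mem_kstar L, rfl⟩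
    | mul x y _ _ hx hy =>
      obtain ⟨u, hu, rfl⟩ := hx
      obtain ⟨v, hv, rfl⟩ := hy
      refine ⟨u ++ v, ?_, wordEval_append ev u v⟩
      have : u ++ v ∈ KStar.kstar L * KStar.kstar L := Language.append_mem_mul hu hv
      rwa [kstar_mul_kstar] at this

end IsRationalSubset

/-- A left-order whose positive cone is rational is regular: the inverses of the letters can be
added to the alphabet, which then generates the group as a monoid. -/
theorem IsLeftOrder.isRegularLeftOrder {G : Type u} [Group G] {lt : G → G → Prop}
    (h : IsLeftOrder G lt) (hR : IsRationalSubset (positiveCone lt)) :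
    IsRegularLeftOrder G lt := by
  refine ⟨h, ?_⟩
  obtain ⟨X, hX, ev, L, M, hL, hM, hLe, hMe⟩ := hR.exists_common hR.inv
  refine ⟨X, hX, ev, fun g ↦ ?_, L, hL, hLe⟩
  have := h.strictTotal
  rcases trichotomous_of lt 1 g with hg | rfl | hg
  · obtain ⟨w, -, hw⟩ := hLe.symm.subset hg
    exact ⟨w, hw⟩
  · exact ⟨[], rfl⟩
  · obtain ⟨w, -, hw⟩ := hMe.symm.subset
      (show lt 1 g⁻¹ by rwa [← h.mul_left_iff _ _ g, mul_one, mul_inv_cancel])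
    exact ⟨w, hw⟩

/-! ### Alternating products and the cone of a twisted pair -/

/-- Products of elements that are taken alternately from the sets `s true` and `s false`; the index
tells to which set the first factor belongs. -/
inductive IsAlternating {H : Type u} [Group H] (s : Bool → Set H) : Bool → H → Prop
  | single {i : Bool} {x : H} : x ∈ s i → IsAlternating s i x
  | cons {i : Bool} {x y : H} : x ∈ s i → IsAlternating s (!i) y → IsAlternating s i (x * y)

namespace IsAlternating

variable {H : Type u} [Group H] {s : Bool → Set H}

theorem cons_false {x y : H} (hx : x ∈ s false) (hy : IsAlternating s true y) :
    IsAlternating s false (x * y) := .cons hx hy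

theorem map {K : Type v} [Group K] {t : Bool → Set K} (f : H →* K)
    (hf : ∀ i, ∀ x ∈ s i, f x ∈ t i) {i : Bool} {x : H} (hx : IsAlternating s i x) :
    IsAlternating t i (f x) := by
  induction hx with
  | single h => exact .single (hf _ _ h)
  | cons h _ ih => rw [map_mul]; exact .cons (hf _ _ h) ih

theorem swap {i : Bool} {x : H} (hx : IsAlternating s i x) :
    IsAlternating (fun j ↦ s !j) (!i) x := by
  induction hx with
  | single h => exact .single (by simpa using h)
  | cons h _ ih => exact .cons (by simpa using h) ih

/-- A product that starts in `s i` is either a single factor or a factor followed by a product that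
starts in the other set. -/
theorem exists_head {i : Bool} {x : H} (hx : IsAlternating s i x) :
    ∃ y ∈ s i, ∃ r, (r = 1 ∨ IsAlternating s (!i) r) ∧ x = y * r := by
  cases hx with
  | single h => exact ⟨x, h, 1, .inl rfl, (mul_one x).symm⟩
  | cons h h' => exact ⟨_, h, _, .inr h', rfl⟩

end IsAlternating

/-- A pair of subsets of a group each of which is closed under multiplication, up to a central
element `z`: products of two elements of `s true` may have an additional factor `z` and products of
two elements of `s false` an additional factor `z⁻¹`. -/
structure IsTwistedPair {H : Type u} [Group H] (s : Bool → Set H) (z : H) : Prop where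
  central : ∀ h : H, Commute z h
  mul_true : ∀ x ∈ s true, ∀ y ∈ s true, x * y = z ∨ x * y ∈ s true ∨ ∃ u ∈ s true, x * y = u * z
  mul_false : ∀ x ∈ s false, ∀ y ∈ s false,
    x * y = z⁻¹ ∨ x * y ∈ s false ∨ ∃ u ∈ s false, x * y = u * z⁻¹

/-- The products of an alternating product by a power of `z`, whose exponent is at least `0` if the
alternating product starts in `s true` and at least `m` otherwise. -/
inductive AlternatingCone {H : Type u} [Group H] (s : Bool → Set H) (z : H) (m : ℕ) : H → Prop
  | pow {k : ℕ} : m ≤ k → AlternatingCone s z m (z ^ k)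
  | mul_pow_true {x : H} (k : ℕ) : IsAlternating s true x → AlternatingCone s z m (x * z ^ k)
  | mul_pow_false {x : H} {k : ℕ} : m ≤ k → IsAlternating s false x →
      AlternatingCone s z m (x * z ^ k)

namespace AlternatingCone

variable {H : Type u} [Group H] {s : Bool → Set H} {z : H}

theorem of_alternating_true {m : ℕ} {x : H} (hx : IsAlternating s true x) :
    AlternatingCone s z m x := by
  simpa using AlternatingCone.mul_pow_true (z := z) (m := m) 0 hx

theorem zero_of_one {x : H} (hx : AlternatingCone s z 1 x) : AlternatingCone s z 0 x := by
  cases hx with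
  | pow h => exact .pow (Nat.zero_le _)
  | mul_pow_true k h => exact .mul_pow_true k h
  | mul_pow_false h h' => exact .mul_pow_false (Nat.zero_le _) h'

theorem mul_z {m n : ℕ} (hmn : n ≤ m + 1) {x : H} (hx : AlternatingCone s z m x) :
    AlternatingCone s z n (x * z) := by
  cases hx with
  | @pow k h => rw [← pow_succ]; exact .pow (by omega)
  | mul_pow_true k h => rw [mul_assoc, ← pow_succ]; exact .mul_pow_true _ h
  | mul_pow_false h h' => rw [mul_assoc, ← pow_succ]; exact .mul_pow_false (by omega) h'

theorem mul_z_pow {m : ℕ} {x : H} (hx : AlternatingCone s z m x) (k : ℕ) :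
    AlternatingCone s z m (x * z ^ k) := by
  induction k with
  | zero => simpa using hx
  | succ k ih => rw [pow_succ, ← mul_assoc]; exact mul_z (Nat.le_succ m) ih

end AlternatingCone

namespace IsTwistedPair

variable {H : Type u} [Group H] {s : Bool → Set H} {z : H}

/-- This symmetry turns every statement about the positive cone into one about the negative cone. -/
theorem swap (h : IsTwistedPair s z) : IsTwistedPair (fun i ↦ s !i) z⁻¹ where
  central g := (h.central g).inv_left
  mul_true := by simpa using h.mul_false
  mul_false := by simpa using h.mul_true

/-- Multiplication of the elements of the larger cone by an element of `s true`. -/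
theorem mul_mem_of_true (h : IsTwistedPair s z) {x p : H} (hx : x ∈ s true)
    (hp : AlternatingCone s z 0 p) : AlternatingCone s z 1 (x * p) := by
  cases hp with
  | pow _ => exact .mul_pow_true _ (.single hx)
  | mul_pow_false _ hw => rw [← mul_assoc]; exact .mul_pow_true _ (.cons hx hw)
  | @mul_pow_true w k hw =>
    rw [← mul_assoc]
    refine AlternatingCone.mul_z_pow ?_ k
    obtain ⟨y, hy, r, hr, rfl⟩ := hw.exists_head
    have hur : ∀ u ∈ s true, AlternatingCone s z 1 (u * r) := by
      rintro u hu
      rcases hr with rfl | hr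
      · rw [mul_one]; exact .of_alternating_true (.single hu)
      · exact .of_alternating_true (.cons hu hr)
    rw [← mul_assoc]
    rcases h.mul_true x hx y hy with he | he | ⟨u, hu, he⟩
    · rw [he, (h.central r).eq]
      rcases hr with rfl | hr
      · simpa using AlternatingCone.pow (s := s) (z := z) (le_refl 1)
      · simpa using AlternatingCone.mul_pow_false (z := z) (le_refl 1) hr
    · exact hur _ he
    · rw [he, mul_assoc, (h.central r).eq, ← mul_assoc]
      exact AlternatingCone.mul_z (by omega) (hur u hu)

/-- Multiplication of the elements of the smaller cone by an element of `s false`. -/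
theorem mul_mem_of_false (h : IsTwistedPair s z) {x p : H} (hx : x ∈ s false)
    (hp : AlternatingCone s z 1 p) : AlternatingCone s z 0 (x * p) := by
  cases hp with
  | pow _ => exact .mul_pow_false (Nat.zero_le _) (.single hx)
  | mul_pow_true k hw => rw [← mul_assoc]; exact .mul_pow_false (Nat.zero_le _) (.cons hx hw)
  | @mul_pow_false w k hk hw =>
    obtain ⟨k, rfl⟩ := Nat.exists_eq_add_of_le' hk
    -- One `z` is split off, as `k ≥ 1`, to pay for a `z⁻¹` produced by the first two letters.
    rw [pow_succ', ← mul_assoc, ← mul_assoc]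
    refine AlternatingCone.mul_z_pow ?_ k
    obtain ⟨y, hy, r, hr, rfl⟩ := hw.exists_head
    have hur : ∀ u ∈ s false, AlternatingCone s z 0 (u * r) := by
      rintro u hu
      have key : IsAlternating s false (u * r) := by
        rcases hr with rfl | hr
        · rw [mul_one]; exact .single hu
        · exact .cons hu hr
      simpa using AlternatingCone.mul_pow_false (z := z) (Nat.zero_le 0) key
    rw [← mul_assoc]
    rcases h.mul_false x hx y hy with he | he | ⟨u, hu, he⟩
    · rw [he, mul_assoc, ← (h.central r).eq, inv_mul_cancel_left]
      rcases hr with rfl | hr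
      · simpa using AlternatingCone.pow (s := s) (z := z) (le_refl 0)
      · exact .of_alternating_true hr
    · exact AlternatingCone.mul_z (by omega) (hur _ he)
    · rw [he, mul_assoc, mul_assoc, ← (h.central r).eq, inv_mul_cancel_left]
      exact hur u hu

/-- The letters of `x`, applied from the right, carry `p` back and forth between the two cones: `s
true` maps the larger into the smaller, `s false` the smaller into the larger. The first letter of
`x` decides where the product ends. -/
theorem alternating_mul_mem (h : IsTwistedPair s z) {p : H} (hp : AlternatingCone s z 1 p)
    {i : Bool} {x : H} (hx : IsAlternating s i x) :
    AlternatingCone s z (bif i then 1 else 0) (x * p) := by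
  induction hx with
  | @single i x hx =>
    cases i with
    | true => exact h.mul_mem_of_true hx hp.zero_of_one
    | false => exact h.mul_mem_of_false hx hp
  | @cons i x y hx _ ih =>
    rw [mul_assoc]
    cases i with
    | true => exact h.mul_mem_of_true hx ih
    | false => exact h.mul_mem_of_false hx ih

/-- The elements of the smaller cone form a semigroup. -/
theorem mul_mem (h : IsTwistedPair s z) {x p : H} (hx : AlternatingCone s z 1 x)
    (hp : AlternatingCone s z 1 p) : AlternatingCone s z 1 (x * p) := by
  cases hx with
  | pow _ =>
    rw [((h.central p).pow_left _).eq]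
    exact hp.mul_z_pow _
  | mul_pow_true k hx =>
    rw [mul_assoc, ((h.central p).pow_left _).eq, ← mul_assoc]
    exact (h.alternating_mul_mem hp hx).mul_z_pow _
  | @mul_pow_false x k hk hx =>
    obtain ⟨k, rfl⟩ := Nat.exists_eq_add_of_le' hk
    rw [mul_assoc, ((h.central p).pow_left _).eq, ← mul_assoc, pow_succ', ← mul_assoc]
    -- A product that starts in `s false` only reaches the larger cone; one of its factors `z`
    -- brings it back into the smaller one.
    exact ((h.alternating_mul_mem hp hx).mul_z (le_refl 1)).mul_z_pow _

/-- If `s true`, `s false` and `z` generate the group, then every element is the product of an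
alternating product, or of `1`, by a power of `z`. -/
theorem exists_normal_form (h : IsTwistedPair s z)
    (hgen : Submonoid.closure (s true ∪ s false ∪ {z, z⁻¹}) = ⊤) (g : H) :
    ∃ k : ℤ, g = z ^ k ∨ ∃ i x, IsAlternating s i x ∧ g = x * z ^ k := by
  have hz : ∀ (e k : ℤ) (r : H), z ^ e * (r * z ^ k) = r * z ^ (e + k) := fun e k r ↦ by
    rw [← mul_assoc, ((h.central r).zpow_left e).eq, mul_assoc, zpow_add]
  have hletter : ∀ i, ∀ x ∈ s i, ∀ y ∈ s i,
      (∃ e : ℤ, x * y = z ^ e) ∨ ∃ u ∈ s i, ∃ e : ℤ, x * y = u * z ^ e := by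
    intro i x hx y hy
    cases i with
    | true =>
      rcases h.mul_true x hx y hy with he | he | ⟨u, hu, he⟩
      · exact .inl ⟨1, by simpa using he⟩
      · exact .inr ⟨_, he, 0, by simp⟩
      · exact .inr ⟨u, hu, 1, by simpa using he⟩
    | false =>
      rcases h.mul_false x hx y hy with he | he | ⟨u, hu, he⟩
      · exact .inl ⟨-1, by simpa using he⟩
      · exact .inr ⟨_, he, 0, by simp⟩
      · exact .inr ⟨u, hu, -1, by simpa using he⟩
  have hstep : ∀ i, ∀ x ∈ s i, ∀ g : H,
      (∃ k : ℤ, g = z ^ k ∨ ∃ i x, IsAlternating s i x ∧ g = x * z ^ k) →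
      ∃ k : ℤ, x * g = z ^ k ∨ ∃ j y, IsAlternating s j y ∧ x * g = y * z ^ k := by
    rintro i x hx _ ⟨k, rfl | ⟨j, w, hw, rfl⟩⟩
    · exact ⟨k, .inr ⟨i, x, .single hx, rfl⟩⟩
    · obtain rfl | rfl := Bool.eq_or_eq_not j i
      · obtain ⟨y, hy, r, hr, rfl⟩ := hw.exists_head
        rw [← mul_assoc, ← mul_assoc, mul_assoc]
        rcases hletter _ x hx y hy with ⟨e, he⟩ | ⟨u, hu, e, he⟩
        · rw [he, hz]
          rcases hr with rfl | hr
          · exact ⟨_, .inl (one_mul _)⟩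
          · exact ⟨_, .inr ⟨_, r, hr, rfl⟩⟩
        · rw [he, mul_assoc, hz, ← mul_assoc]
          rcases hr with rfl | hr
          · exact ⟨_, .inr ⟨_, u, .single hu, by rw [mul_one]⟩⟩
          · exact ⟨_, .inr ⟨_, _, .cons hu hr, rfl⟩⟩
      · exact ⟨k, .inr ⟨i, x * w, .cons hx hw, (mul_assoc _ _ _).symm⟩⟩
  have hzstep : ∀ (e : ℤ) (g : H),
      (∃ k : ℤ, g = z ^ k ∨ ∃ i x, IsAlternating s i x ∧ g = x * z ^ k) →
      ∃ k : ℤ, z ^ e * g = z ^ k ∨ ∃ j y, IsAlternating s j y ∧ z ^ e * g = y * z ^ k := by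
    rintro e _ ⟨k, rfl | ⟨j, w, hw, rfl⟩⟩
    · exact ⟨e + k, .inl (zpow_add z e k).symm⟩
    · exact ⟨e + k, .inr ⟨j, w, hw, hz e k w⟩⟩
  have hg : g ∈ Submonoid.closure (s true ∪ s false ∪ {z, z⁻¹}) := hgen ▸ Submonoid.mem_top g
  induction hg using Submonoid.closure_induction_left with
  | one => exact ⟨0, .inl (zpow_zero z).symm⟩
  | mul_left x hx y _ ih =>
    rcases hx with (hx | hx) | rfl | rfl
    · exact hstep true x hx y ih
    · exact hstep false x hx y ih
    · simpa using hzstep 1 y ih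
    · simpa using hzstep (-1) y ih

/-- The left-order on a group in which alternating products are never powers of the central element
`z`: its positive cone is the smaller alternating cone. -/
theorem isLeftOrder (h : IsTwistedPair s z)
    (hgen : Submonoid.closure (s true ∪ s false ∪ {z, z⁻¹}) = ⊤)
    (hfree : ∀ i x (k : ℤ), IsAlternating s i x → x ≠ z ^ k) (hz : ∀ k : ℕ, z ^ (k + 1) ≠ 1) :
    IsLeftOrder H fun x y ↦ AlternatingCone s z 1 (x⁻¹ * y) := by
  have hone : ∀ (t : Bool → Set H) (y : H), (∀ i x (k : ℤ), IsAlternating t i x → x ≠ y ^ k) →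
      (∀ k : ℕ, y ^ (k + 1) ≠ 1) → ¬ AlternatingCone t y 1 1 := by
    intro t y ht hy hc
    have aux : ∀ i x (k : ℕ), IsAlternating t i x → (1 : H) = x * y ^ k → False :=
      fun i x k hx he ↦ ht i x (-k) hx (by
        rw [zpow_neg, zpow_natCast]; exact eq_inv_of_mul_eq_one_left he.symm)
    generalize hg : (1 : H) = g at hc
    cases hc with
    | @pow k hk =>
      obtain ⟨k, rfl⟩ := Nat.exists_eq_add_of_le' hk
      exact hy k hg.symm
    | mul_pow_true k hx => exact aux _ _ _ hx hg
    | mul_pow_false _ hx => exact aux _ _ _ hx hg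
  have hpos := hone s z hfree hz
  have hneg : ¬ AlternatingCone (fun i ↦ s !i) z⁻¹ 1 1 := by
    refine hone _ _ (fun i x k hx he ↦ ?_) fun k hk ↦ hz k ?_
    · exact hfree (!i) x (-k) (by simpa using hx.swap) (by rw [he, inv_zpow'])
    · simpa using hk
  -- The thresholds `0` and `1` complement each other: with exponent `0`, a start in `s true` is
  -- positive and a start in `s false` is negative.
  have htri : ∀ g : H, AlternatingCone s z 1 g ∨ g = 1 ∨ AlternatingCone (fun i ↦ s !i) z⁻¹ 1 g := by
    intro g
    obtain ⟨k, hk⟩ := h.exists_normal_form hgen g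
    rcases hk with rfl | ⟨i, x, hx, rfl⟩
    · rcases lt_trichotomy k 0 with hk | rfl | hk
      · obtain ⟨n, rfl⟩ := Int.exists_eq_neg_ofNat hk.le
        refine .inr (.inr ?_)
        rw [zpow_neg, zpow_natCast, ← inv_pow]
        exact .pow (by omega)
      · exact .inr (.inl (zpow_zero z))
      · lift k to ℕ using hk.le
        rw [zpow_natCast]
        exact .inl (.pow (by omega))
    · rcases lt_trichotomy k 0 with hk | rfl | hk
      · obtain ⟨n, rfl⟩ := Int.exists_eq_neg_ofNat hk.le
        refine .inr (.inr ?_)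
        rw [zpow_neg, zpow_natCast, ← inv_pow]
        cases i with
        | true => exact .mul_pow_false (by omega) hx.swap
        | false => exact .mul_pow_true _ hx.swap
      · rw [zpow_zero, mul_one]
        cases i with
        | true => exact .inl (.of_alternating_true hx)
        | false => exact .inr (.inr (.of_alternating_true hx.swap))
      · lift k to ℕ using hk.le
        rw [zpow_natCast]
        cases i with
        | true => exact .inl (.mul_pow_true _ hx)
        | false => exact .inl (.mul_pow_false (by omega) hx)
  exact
    { strictTotal :=
        { irrefl := fun a ha ↦ hpos (by simpa using ha)
          trans := fun a b c hab hbc ↦ by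
            have := h.mul_mem hab hbc
            rwa [mul_assoc, mul_inv_cancel_left] at this
          trichotomous := fun a b hab hba ↦ by
            by_contra hne
            have hne' : a⁻¹ * b ≠ 1 := fun he ↦ hne (inv_mul_eq_one.1 he)
            have h1 := ((htri (a⁻¹ * b)).resolve_left hab).resolve_left hne'
            have hne'' : b⁻¹ * a ≠ 1 := fun he ↦ hne (inv_mul_eq_one.1 he).symm
            have h2 := ((htri (b⁻¹ * a)).resolve_left hba).resolve_left hne''
            -- Two mutually inverse elements of the negative cone would have product `1` in it.
            exact hneg (by simpa [mul_assoc] using h.swap.mul_mem h1 h2) }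
      mul_left_iff := fun a b c ↦ by simp [mul_assoc] }

open scoped Pointwise in
/-- The smaller alternating cone is a rational subset if the given subsets are. -/
theorem isRationalSubset (h : IsTwistedPair s z) (hs : ∀ i, IsRationalSubset (s i)) :
    IsRationalSubset {g | AlternatingCone s z 1 g} := by
  -- The cone is the semigroup generated by `T`: an alternating product is cut so that each letter
  -- of `s false` is attached to the letter of `s true` before it, or to a factor `z` if it comes
  -- first.
  set T : Set H := s true ∪ s true * s false ∪ {z} * s false ∪ {z} with hT
  have hTrat : IsRationalSubset T :=
    (((hs true).union ((hs true).mul (hs false))).union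
      ((IsRationalSubset.singleton z).mul (hs false))).union (.singleton z)
  have hTcone : ∀ t ∈ T, AlternatingCone s z 1 t := by
    rintro t (((ht | ⟨x, hx, y, hy, rfl⟩) | ⟨t, ht, x, hx, rfl⟩) | rfl)
    · exact .of_alternating_true (.single ht)
    · exact .of_alternating_true (.cons hx (.single hy))
    · change AlternatingCone s z 1 (t * x)
      rw [show t = z from ht, (h.central x).eq]
      simpa using AlternatingCone.mul_pow_false (z := z) (le_refl 1) (.single hx)
    · simpa using AlternatingCone.pow (s := s) (z := t) (le_refl 1)
  -- The prefix `t` is what a leading letter of `s false` has to be attached to; a product that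
  -- starts in `s true` needs none.
  have hC : ∀ i x, IsAlternating s i x → ∀ t ∈ (bif i then {1} else insert z (s true) : Set H),
      ∃ a ∈ T, ∃ c ∈ Submonoid.closure T, t * x = a * c := by
    intro i x hx
    induction hx with
    | @single i x hx =>
      cases i with
      | true =>
        rintro _ rfl
        exact ⟨x, .inl (.inl (.inl hx)), 1, one_mem _, by simp⟩
      | false =>
        rintro t (rfl | ht)
        · exact ⟨_, .inl (.inr ⟨t, rfl, x, hx, rfl⟩), 1, one_mem _, by simp⟩
        · exact ⟨_, .inl (.inl (.inr ⟨t, ht, x, hx, rfl⟩)), 1, one_mem _, by simp⟩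
    | @cons i x y hx _ ih =>
      cases i with
      | true =>
        rintro _ rfl
        rw [one_mul]
        exact ih x (.inr hx)
      | false =>
        obtain ⟨a, ha, c, hc, he⟩ := ih 1 rfl
        rw [one_mul] at he
        subst he
        have hac := Submonoid.mul_mem _ (Submonoid.subset_closure ha) hc
        rintro t (rfl | ht)
        · exact ⟨_, .inl (.inr ⟨t, rfl, x, hx, rfl⟩), _, hac, (mul_assoc _ _ _).symm⟩
        · exact ⟨_, .inl (.inl (.inr ⟨t, ht, x, hx, rfl⟩)), _, hac, (mul_assoc _ _ _).symm⟩
  have hzT : z ∈ Submonoid.closure T := Submonoid.subset_closure (.inr rfl)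
  have hzC : ∀ (k : ℕ) (g : H), (∃ a ∈ T, ∃ c ∈ Submonoid.closure T, g = a * c) →
      g * z ^ k ∈ T * (Submonoid.closure T : Set H) := by
    rintro k _ ⟨a, ha, c, hc, rfl⟩
    exact ⟨a, ha, _, Submonoid.mul_mem _ hc (pow_mem hzT k), (mul_assoc _ _ _).symm⟩
  have hcone : {g | AlternatingCone s z 1 g} = T * (Submonoid.closure T : Set H) := by
    ext g
    constructor
    · rintro (@⟨k, hk⟩ | @⟨x, k, hx⟩ | @⟨x, k, hk, hx⟩)
      · obtain ⟨k, rfl⟩ := Nat.exists_eq_add_of_le' hk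
        rw [pow_succ']
        exact ⟨z, .inr rfl, z ^ k, pow_mem hzT k, rfl⟩
      · exact hzC k x (by simpa using hC true x hx 1 rfl)
      · obtain ⟨k, rfl⟩ := Nat.exists_eq_add_of_le' hk
        rw [pow_succ', ← mul_assoc, ← (h.central x).eq]
        exact hzC k _ (hC false x hx z (.inl rfl))
    · rintro ⟨t, ht, c, hc, rfl⟩
      have hc' : c ∈ Submonoid.closure T := hc
      clear hc
      change AlternatingCone s z 1 (t * c)
      induction hc' using Submonoid.closure_induction_right with
      | one => simpa using hTcone t ht
      | mul_right x _ y hy ih => rw [← mul_assoc]; exact h.mul_mem ih (hTcone y hy)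
  rw [hcone]
  exact hTrat.mul hTrat.submonoidClosure

end IsTwistedPair

/-! ### Twisted images of left-ordered groups -/

namespace IsLeftOrder

variable {G : Type u} [Group G] {lt : G → G → Prop}

theorem flip (h : IsLeftOrder G lt) : IsLeftOrder G fun a b ↦ lt b a where
  strictTotal :=
    have := h.strictTotal
    { irrefl := fun a ↦ irrefl_of lt a
      trans := fun _ _ _ hab hbc ↦ trans_of lt hbc hab
      trichotomous := fun a b hab hba ↦ Std.Trichotomous.trichotomous (r := lt) a b hba hab }
  mul_left_iff a b c := h.mul_left_iff b a c

theorem one_lt_mul (h : IsLeftOrder G lt) {a b : G} (ha : lt 1 a) (hb : lt 1 b) :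
    lt 1 (a * b) :=
  have := h.strictTotal
  trans_of lt ha (by simpa using (h.mul_left_iff 1 b a).2 hb)

theorem one_lt_inv_iff (h : IsLeftOrder G lt) {a : G} : lt 1 a⁻¹ ↔ lt a 1 := by
  rw [← h.mul_left_iff 1 a⁻¹ a, mul_one, mul_inv_cancel]

theorem inv_positiveCone (h : IsLeftOrder G lt) :
    (positiveCone lt)⁻¹ = positiveCone fun a b ↦ lt b a := by
  ext a
  exact h.one_lt_inv_iff

end IsLeftOrder

theorem IsRegularLeftOrder.isRationalSubset {G : Type u} [Group G] {lt : G → G → Prop}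
    (h : IsRegularLeftOrder G lt) : IsRationalSubset (positiveCone lt) := by
  obtain ⟨X, hX, ev, -, L, hL, he⟩ := h.exists_language
  exact ⟨X, hX, ev, L, hL, he⟩

/-- The images under `f` of the positive elements, and the products by `z` of the images of the
negative elements. -/
def twistedImage {G : Type u} {H : Type v} [Group G] [Group H] (lt : G → G → Prop) (f : G →* H)
    (z : H) : Set H :=
  {x | ∃ a, lt 1 a ∧ x = f a} ∪ {x | ∃ a, lt a 1 ∧ x = f a * z}

section twistedImage

variable {G : Type u} {H : Type v} [Group G] [Group H] {lt : G → G → Prop}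

/-- Positive times positive needs no `z`. A mixed product is `f c * z`, where the sign of `c`
decides between the three alternatives. Two negative factors bring `z` twice, one more than the
product needs. -/
theorem IsLeftOrder.twistedImage_mul (h : IsLeftOrder G lt) (f : G →* H) {z : H}
    (hz : ∀ g : H, Commute z g) {x y : H} (hx : x ∈ twistedImage lt f z)
    (hy : y ∈ twistedImage lt f z) :
    x * y = z ∨ x * y ∈ twistedImage lt f z ∨ ∃ u ∈ twistedImage lt f z, x * y = u * z := by
  have := h.strictTotal
  have key : ∀ c : G, f c * z = z ∨ f c * z ∈ twistedImage lt f z ∨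
      ∃ u ∈ twistedImage lt f z, f c * z = u * z := by
    intro c
    rcases trichotomous_of lt 1 c with hc | rfl | hc
    · exact .inr (.inr ⟨f c, .inl ⟨c, hc, rfl⟩, rfl⟩)
    · exact .inl (by simp)
    · exact .inr (.inl (.inr ⟨c, hc, rfl⟩))
  rcases hx with ⟨a, ha, rfl⟩ | ⟨a, ha, rfl⟩ <;> rcases hy with ⟨b, hb, rfl⟩ | ⟨b, hb, rfl⟩
  · exact .inr (.inl (.inl ⟨a * b, h.one_lt_mul ha hb, (map_mul f a b).symm⟩))
  · rw [← mul_assoc, ← map_mul]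
    exact key _
  · rw [mul_assoc, (hz _).eq, ← mul_assoc, ← map_mul]
    exact key _
  · refine .inr (.inr ⟨f (a * b) * z, .inr ⟨a * b, h.flip.one_lt_mul ha hb, rfl⟩, ?_⟩)
    rw [map_mul, mul_assoc, ← mul_assoc z, (hz (f b)).eq]
    simp only [mul_assoc]

theorem IsLeftOrder.isRationalSubset_twistedImage (h : IsLeftOrder G lt)
    (hR : IsRationalSubset (positiveCone lt)) (f : G →* H) (z : H) :
    IsRationalSubset (twistedImage lt f z) := by
  refine ((hR.image f).union ((hR.inv.image f).mul (.singleton z))).of_eq ?_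
  rw [h.inv_positiveCone]
  ext x
  constructor
  · rintro (⟨a, ha, rfl⟩ | ⟨_, ⟨a, ha, rfl⟩, _, rfl, rfl⟩)
    · exact .inl ⟨a, ha, rfl⟩
    · exact .inr ⟨a, ha, rfl⟩
  · rintro (⟨a, ha, rfl⟩ | ⟨a, ha, rfl⟩)
    · exact .inl ⟨a, ha, rfl⟩
    · exact .inr ⟨_, ⟨a, ha, rfl⟩, _, rfl, rfl⟩

theorem IsLeftOrder.map_mem_of_twistedImage_subset (h : IsLeftOrder G lt) {f : G →* H} {z : H}
    {S : Submonoid H} (hS : twistedImage lt f z ⊆ S) (hz : z⁻¹ ∈ S) (a : G) : f a ∈ S := by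
  have := h.strictTotal
  rcases trichotomous_of lt 1 a with ha | rfl | ha
  · exact hS (.inl ⟨a, ha, rfl⟩)
  · rw [map_one]; exact one_mem S
  · simpa using mul_mem (hS (.inr ⟨a, ha, rfl⟩)) hz

end twistedImage

/-! ### Normal forms in a free product -/

namespace Monoid.Coprod

variable (A : Type u) (B : Type v) [Group A] [Group B]

/-- The non-trivial elements of the two factors of a free product. -/
def letters : Bool → Set (Monoid.Coprod A B)
  | true => inl '' {1}ᶜ
  | false => inr '' {1}ᶜ

/-- The factors of a binary free product, as a family in a single universe. -/
def Factor : Bool → Type (max u v)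
  | true => ULift.{v} A
  | false => ULift.{u} B

instance (i : Bool) : Group (Factor A B i) :=
  match i with
  | true => inferInstanceAs (Group (ULift.{v} A))
  | false => inferInstanceAs (Group (ULift.{u} B))

/-- The comparison of the binary free product with the free product of a family. -/
def toCoprodI : Monoid.Coprod A B →* Monoid.CoprodI (Factor A B) :=
  lift ((CoprodI.of (M := Factor A B) (i := true)).comp MulEquiv.ulift.symm.toMonoidHom)
    ((CoprodI.of (M := Factor A B) (i := false)).comp MulEquiv.ulift.symm.toMonoidHom)

variable {A B}

theorem exists_toCoprodI_eq {i : Bool} {x : Monoid.Coprod A B} (hx : x ∈ letters A B i) :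
    ∃ y : Factor A B i, y ≠ 1 ∧ toCoprodI A B x = CoprodI.of y := by
  cases i with
  | true =>
    obtain ⟨a, ha, rfl⟩ := hx
    exact ⟨ULift.up a, fun h ↦ ha (congrArg ULift.down h), rfl⟩
  | false =>
    obtain ⟨b, hb, rfl⟩ := hx
    exact ⟨ULift.up b, fun h ↦ hb (congrArg ULift.down h), rfl⟩

/-- An alternating product is a reduced word, so the uniqueness of reduced words in `Monoid.CoprodI`
applies to it. -/
theorem exists_neWord {i : Bool} {x : Monoid.Coprod A B}
    (hx : IsAlternating (letters A B) i x) :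
    ∃ (j : Bool) (w : CoprodI.NeWord (Factor A B) i j), toCoprodI A B x = w.prod := by
  induction hx with
  | single h =>
    obtain ⟨y, hy, he⟩ := exists_toCoprodI_eq h
    exact ⟨_, .singleton y hy, by rw [he, CoprodI.NeWord.prod_singleton]⟩
  | @cons i _ _ h _ ih =>
    obtain ⟨y, hy, he⟩ := exists_toCoprodI_eq h
    obtain ⟨j, w, hw⟩ := ih
    have hi : i ≠ !i := by cases i <;> simp
    refine ⟨j, .append (.singleton y hy) hi w, ?_⟩
    rw [map_mul, he, hw, CoprodI.NeWord.append_prod, CoprodI.NeWord.prod_singleton]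

theorem alternating_ne_one {i : Bool} {x : Monoid.Coprod A B}
    (hx : IsAlternating (letters A B) i x) : x ≠ 1 := by
  classical
  rintro rfl
  obtain ⟨j, w, hw⟩ := exists_neWord hx
  have h : w.toWord.prod = (CoprodI.Word.empty : CoprodI.Word (Factor A B)).prod := by
    rw [CoprodI.Word.prod_empty, ← map_one (toCoprodI A B), hw]; rfl
  have h' : w.toWord = CoprodI.Word.empty := CoprodI.Word.equiv.symm.injective h
  exact w.toList_ne_nil (congrArg CoprodI.Word.toList h')

theorem not_alternating_of_alternating {i : Bool} {x : Monoid.Coprod A B}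
    (hx : IsAlternating (letters A B) i x) : ¬ IsAlternating (letters A B) (!i) x := by
  classical
  intro hx'
  obtain ⟨j, w, hw⟩ := exists_neWord hx
  obtain ⟨j', w', hw'⟩ := exists_neWord hx'
  have h : w.toWord.prod = w'.toWord.prod := hw.symm.trans hw'
  have h' : w.toList = w'.toList :=
    congrArg CoprodI.Word.toList (CoprodI.Word.equiv.symm.injective h)
  have h'' := w.toList_head?.symm.trans ((congrArg List.head? h').trans w'.toList_head?)
  have := congrArg Sigma.fst (Option.some.inj h'')
  cases i <;> simp at this

theorem letters_mul {i : Bool} {x y : Monoid.Coprod A B} (hx : x ∈ letters A B i)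
    (hy : y ∈ letters A B i) : x * y = 1 ∨ x * y ∈ letters A B i := by
  cases i with
  | true =>
    obtain ⟨a, -, rfl⟩ := hx
    obtain ⟨b, -, rfl⟩ := hy
    rw [← map_mul]
    rcases eq_or_ne (a * b) 1 with h | h
    · exact .inl (by rw [h, map_one])
    · exact .inr ⟨_, h, rfl⟩
  | false =>
    obtain ⟨a, -, rfl⟩ := hx
    obtain ⟨b, -, rfl⟩ := hy
    rw [← map_mul]
    rcases eq_or_ne (a * b) 1 with h | h
    · exact .inl (by rw [h, map_one])
    · exact .inr ⟨_, h, rfl⟩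

theorem eq_one_or_alternating (x : Monoid.Coprod A B) :
    x = 1 ∨ ∃ i, IsAlternating (letters A B) i x := by
  -- With trivial twist `z = 1`, the normal form of twisted pairs becomes the usual one in a free
  -- product.
  have hp : IsTwistedPair (letters A B) (1 : Monoid.Coprod A B) :=
    { central := fun g ↦ Commute.one_left g
      mul_true := fun x hx y hy ↦ (letters_mul hx hy).imp id .inl
      mul_false := fun x hx y hy ↦ (letters_mul hx hy).imp (by simp) .inl }
  have hmem : ∀ {S : Submonoid (Monoid.Coprod A B)}, (∀ i, letters A B i ⊆ S) → ∀ x, x ∈ S := by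
    intro S hS x
    induction x using induction_on with
    | inl a =>
      rcases eq_or_ne a 1 with rfl | ha
      · simp
      · exact hS true ⟨a, ha, rfl⟩
    | inr b =>
      rcases eq_or_ne b 1 with rfl | hb
      · simp
      · exact hS false ⟨b, hb, rfl⟩
    | mul x y hx hy => exact mul_mem hx hy
  obtain ⟨k, rfl | ⟨i, y, hy, rfl⟩⟩ := hp.exists_normal_form (eq_top_iff.2 fun x _ ↦ hmem (by
    rintro (_ | _) y hy
    · exact Submonoid.subset_closure (.inl (.inr hy))
    · exact Submonoid.subset_closure (.inl (.inl hy))) x) x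
  · exact .inl (one_zpow k)
  · exact .inr ⟨i, by simpa using hy⟩

end Monoid.Coprod

/-! ### The regular left-order on the product with `ℤ` -/

/-- The direct product with `ℤ` of a free product of two groups with regular left-orders admits a
regular left-order. -/
theorem admitsRegularLeftOrder_coprod_prod_int {A : Type u} {B : Type v} [Group A] [Group B]
    (hA : AdmitsRegularLeftOrder A) (hB : AdmitsRegularLeftOrder B) :
    AdmitsRegularLeftOrder (Monoid.Coprod A B × Multiplicative ℤ) := by
  obtain ⟨ltA, hA⟩ := hA
  obtain ⟨ltB, hB⟩ := hB
  have hoA := hA.isLeftOrder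
  -- The order of `B` is reversed so that `b > 1` gives `(b z⁻¹) z`, a positive element: the new
  -- order extends those of both factors.
  have hoB := hB.isLeftOrder.flip
  have hA1 := hoA.strictTotal
  have hB1 := hB.isLeftOrder.strictTotal
  let z : Monoid.Coprod A B × Multiplicative ℤ := (1, Multiplicative.ofAdd 1)
  let f := (MonoidHom.inl (Monoid.Coprod A B) (Multiplicative ℤ)).comp
    (Monoid.Coprod.inl (M := A) (N := B))
  let g := (MonoidHom.inl (Monoid.Coprod A B) (Multiplicative ℤ)).comp
    (Monoid.Coprod.inr (M := A) (N := B))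
  let s : Bool → Set (Monoid.Coprod A B × Multiplicative ℤ) := fun i ↦
    match i with
    | true => twistedImage ltA f z
    | false => twistedImage (fun a b ↦ ltB b a) g z⁻¹
  have hcentral : ∀ h, Commute z h := fun h ↦ Prod.ext (by simp [z]) (mul_comm _ _)
  have hzpow : ∀ k : ℤ, z ^ k = (1, Multiplicative.ofAdd k) := fun k ↦ by
    simp [z, ← ofAdd_zsmul]
  have hs : IsTwistedPair s z :=
    { central := hcentral
      mul_true := fun x hx y hy ↦ hoA.twistedImage_mul f hcentral hx hy
      mul_false := fun x hx y hy ↦ hoB.twistedImage_mul g (fun h ↦ (hcentral h).inv_left) hx hy }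
  have hgen : Submonoid.closure (s true ∪ s false ∪ {z, z⁻¹}) = ⊤ := by
    refine eq_top_iff.2 ?_
    rintro ⟨x, n⟩ -
    have hz : z ∈ Submonoid.closure (s true ∪ s false ∪ {z, z⁻¹}) :=
      Submonoid.subset_closure (.inr (.inl rfl))
    have hz' : z⁻¹ ∈ Submonoid.closure (s true ∪ s false ∪ {z, z⁻¹}) :=
      Submonoid.subset_closure (.inr (.inr rfl))
    have hx : (x, 1) ∈ Submonoid.closure (s true ∪ s false ∪ {z, z⁻¹}) := by
      induction x using Monoid.Coprod.induction_on with
      | inl a =>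
        exact hoA.map_mem_of_twistedImage_subset (f := f) (z := z)
          (fun y hy ↦ Submonoid.subset_closure (.inl (.inl hy))) hz' a
      | inr b =>
        exact hoB.map_mem_of_twistedImage_subset (f := g) (z := z⁻¹)
          (fun y hy ↦ Submonoid.subset_closure (.inl (.inr hy))) (by simpa using hz) b
      | mul x y hx hy => simpa using mul_mem hx hy
    have hn : ∀ k : ℤ, z ^ k ∈ Submonoid.closure (s true ∪ s false ∪ {z, z⁻¹}) := by
      intro k
      obtain ⟨n, rfl | rfl⟩ := Int.eq_nat_or_neg k
      · simpa using pow_mem hz n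
      · simpa using pow_mem hz' n
    have := mul_mem hx (hn n.toAdd)
    rw [hzpow] at this
    simpa using this
  -- Forgetting `z` turns alternating products into reduced words of `A * B`, so they are never
  -- powers of `z`.
  have hfst : ∀ i, ∀ x ∈ s i, MonoidHom.fst _ _ x ∈ Monoid.Coprod.letters A B i := by
    rintro (_ | _) x (⟨a, ha, rfl⟩ | ⟨a, ha, rfl⟩) <;>
      refine ⟨a, ?_, by simp [f, g, z]⟩ <;> rintro rfl
    · exact irrefl_of _ _ ha
    · exact irrefl_of _ _ ha
    · exact irrefl_of _ _ ha
    · exact irrefl_of _ _ ha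
  refine ⟨_, (hs.isLeftOrder hgen (fun i x k hx he ↦ ?_) fun k hk ↦ ?_).isRegularLeftOrder ?_⟩
  · refine Monoid.Coprod.alternating_ne_one (hx.map _ hfst) ?_
    rw [he, hzpow]
    rfl
  · rw [← zpow_natCast, hzpow] at hk
    have := congrArg (fun p ↦ p.2.toAdd) hk
    simp at this
    omega
  · refine (hs.isRationalSubset ?_).of_eq (by simp [positiveCone])
    rintro (_ | _)
    · exact hoB.isRationalSubset_twistedImage
        (hB.isRationalSubset.inv.of_eq hB.isLeftOrder.inv_positiveCone) _ _
    · exact hoA.isRationalSubset_twistedImage hA.isRationalSubset _ _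

/-! ### The obstruction for free products -/

namespace Language

/-- There is a finite set of words such that every initial segment of a word of a regular language
is completed by one of them to a word of the language. -/
theorem IsRegular.exists_finite_completions {T : Type u} {L : Language T} (hL : L.IsRegular) :
    ∃ C : Set (List T), C.Finite ∧ ∀ x y, x ++ y ∈ L → ∃ c ∈ C, x ++ c ∈ L := by
  classical
  have hfin := hL.finite_range_leftQuotient
  -- One completion is chosen for each of the finitely many left quotients; the default `[]` serves
  -- only empty quotients.
  refine ⟨(fun K : Language T ↦ if h : ∃ c, c ∈ K then h.choose else []) ''
    Set.range L.leftQuotient, hfin.image _, fun x y hxy ↦ ?_⟩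
  have h : ∃ c, c ∈ L.leftQuotient x := ⟨y, hxy⟩
  refine ⟨_, ⟨_, ⟨x, rfl⟩, rfl⟩, ?_⟩
  simp only [dif_pos h]
  exact h.choose_spec

end Language

/-- A path that leads out of a set has a step at which it leaves the set. -/
theorem exists_step_out {G : Type u} [Group G] {X : Type v} (ev : X → G) (S : Set G) (w : List X)
    (g : G) (hg : g ∈ S) (hw : g * wordEval ev w ∉ S) :
    ∃ p x q, w = p ++ x :: q ∧ g * wordEval ev p ∈ S ∧ g * wordEval ev p * ev x ∉ S := by
  induction w generalizing g with
  | nil => simp [wordEval, hg] at hw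
  | cons x w ih =>
    by_cases hx : g * ev x ∈ S
    · obtain ⟨p, y, q, rfl, hp, hy⟩ := ih (g * ev x) hx
        (by rwa [mul_assoc, ← wordEval_cons])
      exact ⟨x :: p, y, q, rfl, by rwa [wordEval_cons, ← mul_assoc],
        by rwa [wordEval_cons, ← mul_assoc]⟩
    · exact ⟨[], x, w, rfl, by simpa [wordEval] using hg, by simpa [wordEval] using hx⟩

/-- A finite set is strictly bounded above in a left-order of a non-trivial group. -/
theorem IsLeftOrder.exists_bound {G : Type u} [Group G] [Nontrivial G] {lt : G → G → Prop}
    (h : IsLeftOrder G lt) {F : Set G} (hF : F.Finite) : ∃ m, ∀ x ∈ F, lt x m := by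
  have := h.strictTotal
  induction F, hF using Set.Finite.induction_on with
  | empty => exact ⟨1, by simp⟩
  | @insert a F _ _ ih =>
    obtain ⟨m, hm⟩ := ih
    obtain ⟨e, he⟩ : ∃ e : G, lt 1 e := by
      obtain ⟨g, hg⟩ := exists_ne (1 : G)
      rcases trichotomous_of lt 1 g with h1 | h1 | h1
      · exact ⟨g, h1⟩
      · exact absurd h1.symm hg
      · exact ⟨g⁻¹, h.one_lt_inv_iff.2 h1⟩
    have hlt : ∀ c : G, lt c (c * e) := fun c ↦ by simpa using (h.mul_left_iff 1 e c).2 he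
    rcases trichotomous_of lt a m with h1 | rfl | h1
    · exact ⟨m, by rintro x (rfl | hx); exacts [h1, hm x hx]⟩
    · exact ⟨a * e, by rintro x (rfl | hx); exacts [hlt _, trans_of lt (hm x hx) (hlt _)]⟩
    · exact ⟨a * e, by
        rintro x (rfl | hx); exacts [hlt _, trans_of lt (trans_of lt (hm x hx) h1) (hlt _)]⟩

/-- A group does not admit a regular left-order if it has a subset that right translations change
only in finitely many elements and that left translations by suitable elements move into its
complement, and its complement into it. -/
theorem not_admitsRegularLeftOrder_of_almostInvariant {G : Type u} [Group G] (S : Set G)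
    (hS : ∀ y : G, {x | x ∈ S ∧ x * y ∉ S}.Finite) (a b : G) (ha : ∀ x, x ∉ S → a * x ∈ S)
    (hb : ∀ x, x ∈ S → b * x ∉ S) : ¬ AdmitsRegularLeftOrder G := by
  rintro ⟨lt, h, X, hX, ev, -, L, hL, hLP⟩
  have := h.strictTotal
  have : Nontrivial G := by
    by_cases h1 : (1 : G) ∈ S
    · exact nontrivial_of_ne (b * 1) 1 fun he ↦ hb 1 h1 (by rwa [he])
    · exact nontrivial_of_ne (a * 1) 1 fun he ↦ h1 (he ▸ ha 1 h1)
  obtain ⟨C, hC, hcomp⟩ := hL.exists_finite_completions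
  -- These are the ends of all paths that follow a completion from a point where a letter leads out
  -- of `S`.
  have hF : (Set.image2 (fun x c ↦ x * wordEval ev c)
      (⋃ y : X, {x | x ∈ S ∧ x * ev y ∉ S}) C).Finite :=
    (Set.finite_iUnion fun y ↦ hS (ev y)).image2 _ hC
  obtain ⟨m, hm⟩ := h.exists_bound hF
  obtain ⟨f, hfS, hf⟩ : ∃ f ∈ S, lt m f := by
    -- Both `x` and `a * x` lie above `m`, and one of them is in `S`.
    obtain ⟨x, hx⟩ := h.exists_bound (Set.toFinite {m, a⁻¹ * m})
    by_cases hxS : x ∈ S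
    · exact ⟨x, hxS, hx _ (by simp)⟩
    · refine ⟨a * x, ha x hxS, ?_⟩
      simpa using (h.mul_left_iff _ _ a).2 (hx (a⁻¹ * m) (by simp))
  obtain ⟨t, htS, ht⟩ : ∃ t, t ∉ S ∧ lt f t := by
    obtain ⟨x, hx⟩ := h.exists_bound (Set.toFinite {f, b⁻¹ * f})
    by_cases hxS : x ∈ S
    · refine ⟨b * x, hb x hxS, ?_⟩
      simpa using (h.mul_left_iff _ _ b).2 (hx (b⁻¹ * f) (by simp))
    · exact ⟨x, hxS, hx _ (by simp)⟩
  have hpos : f⁻¹ * t ∈ positiveCone lt := by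
    simpa [positiveCone] using (h.mul_left_iff f t f⁻¹).2 ht
  rw [← hLP] at hpos
  obtain ⟨w, hw, hwt⟩ := hpos
  obtain ⟨p, x, q, rfl, hp, hpx⟩ := exists_step_out ev S w f hfS (by rw [hwt]; simpa using htS)
  obtain ⟨c, hc, hpc⟩ := hcomp p _ hw
  have hlt : lt 1 (wordEval ev (p ++ c)) := hLP.subset ⟨_, hpc, rfl⟩
  rw [← h.mul_left_iff _ _ f, mul_one, wordEval_append, ← mul_assoc] at hlt
  have := hm _ ⟨_, Set.mem_iUnion.2 ⟨x, hp, hpx⟩, c, hc, rfl⟩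
  exact irrefl_of lt m (trans_of lt (trans_of lt hf hlt) this)

namespace Monoid.Coprod

variable {A : Type u} {B : Type v} [Group A] [Group B]

/-- A right translation by a letter turns an alternating product into one that starts in the same
factor, or into `1`. -/
theorem alternating_mul_letter {i j : Bool} {x c : Monoid.Coprod A B}
    (hx : IsAlternating (letters A B) i x) (hc : c ∈ letters A B j) :
    x * c = 1 ∨ IsAlternating (letters A B) i (x * c) := by
  induction hx with
  | @single i x hx =>
    obtain rfl | rfl := Bool.eq_or_eq_not j i
    · exact (letters_mul hx hc).imp id .single
    · exact .inr (.cons hx (.single hc))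
  | cons hx _ ih =>
    rw [mul_assoc]
    rcases ih with h | h
    · exact .inr (by rw [h, mul_one]; exact .single hx)
    · exact .inr (.cons hx h)

/-- A letter `c` can move only `c⁻¹` out of the set, since any other product keeps its first factor.
A product `y * y'` moves out only what `y` does, or what `y` leaves in place and `y'` then moves
out. -/
theorem finite_alternating_mul_not_alternating (i : Bool) (y : Monoid.Coprod A B) :
    {x | IsAlternating (letters A B) i x ∧ ¬ IsAlternating (letters A B) i (x * y)}.Finite := by
  have hletter : ∀ j, ∀ c ∈ letters A B j,
      {x | IsAlternating (letters A B) i x ∧ ¬ IsAlternating (letters A B) i (x * c)}.Finite := by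
    intro j c hc
    refine (Set.finite_singleton c⁻¹).subset ?_
    rintro x ⟨hx, hxc⟩
    exact eq_inv_of_mul_eq_one_left ((alternating_mul_letter hx hc).resolve_right hxc)
  have hone : {x | IsAlternating (letters A B) i x ∧
      ¬ IsAlternating (letters A B) i (x * 1)}.Finite := by simp
  induction y using induction_on with
  | inl a =>
    rcases eq_or_ne a 1 with rfl | ha
    · rwa [map_one]
    · exact hletter true _ ⟨a, ha, rfl⟩
  | inr b =>
    rcases eq_or_ne b 1 with rfl | hb
    · rwa [map_one]
    · exact hletter false _ ⟨b, hb, rfl⟩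
  | mul y y' hy hy' =>
    refine (hy.union (hy'.image (· * y⁻¹))).subset ?_
    rintro x ⟨hx, hxy⟩
    by_cases h : IsAlternating (letters A B) i (x * y)
    · exact .inr ⟨x * y, ⟨h, by rwa [mul_assoc]⟩, by simp⟩
    · exact .inl ⟨hx, h⟩

/-- A free product of two non-trivial groups does not admit a regular left-order. -/
theorem not_admitsRegularLeftOrder [Nontrivial A] [Nontrivial B] :
    ¬ AdmitsRegularLeftOrder (Monoid.Coprod A B) := by
  obtain ⟨a, ha⟩ := exists_ne (1 : A)
  obtain ⟨b, hb⟩ := exists_ne (1 : B)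
  have ha' : inl a ∈ letters A B true := ⟨a, ha, rfl⟩
  have hb' : inr b ∈ letters A B false := ⟨b, hb, rfl⟩
  refine not_admitsRegularLeftOrder_of_almostInvariant {x | IsAlternating (letters A B) true x}
    (finite_alternating_mul_not_alternating true) (inl a) (inr b) (fun x hx ↦ ?_) fun x hx ↦
      not_alternating_of_alternating (.cons_false hb' hx)
  rcases eq_one_or_alternating x with rfl | ⟨_ | _, hx'⟩
  · rw [mul_one]; exact .single ha'
  · exact .cons ha' hx'
  · exact absurd hx' hx

end Monoid.Coprod

theorem mainTheorem4 (A : Type u) (B : Type v) [Group A] [Group B]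
    (hA : AdmitsRegularLeftOrder A) (hB : AdmitsRegularLeftOrder B) :
    AdmitsRegularLeftOrder (Monoid.Coprod A B × Multiplicative ℤ) ∧
      (Nontrivial A → Nontrivial B → ¬ AdmitsRegularLeftOrder (Monoid.Coprod A B)) :=
  ⟨admitsRegularLeftOrder_coprod_prod_int hA hB,
    fun _ _ ↦ Monoid.Coprod.not_admitsRegularLeftOrder⟩
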